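/- Let $K$ be a field, let $G$ be a connected simple graph on $[n]=\{1,\dots,n\}$, and suppose that $G$ is closed with respect to this labelling: whenever $\{i,j\}\ne\{k,l\}$ are edges of $G$ with $i<j$ and $k<l$, then $i=k$ implies that $\{j,l\}$ is an edge, and $j=l$ implies that $\{i,k\}$ is an edge. Let $F_1,\dots,F_r$ be all the maximal cliques of $G$, numbered so that $\min F_1<\dots<\min F_r$ (it is well known that they are intervals $[a_i,b_i]$ of integers with $1=a_1<\dots<a_r$ and $b_r=n$), and put $W_i=F_i\cap F_{i+1}$ for $1\le i\le r-1$ (the connected cut sets of $G$). Let $S=K[x_1,\dots,x_n,y_1,\dots,y_n]$. For a graph $H$ whose vertex set is contained in $[n]$, let $J_H\subseteq S$ be the ideal generated by all $x_iy_j-x_jy_i$ with $i<j$ and $\{i,j\}$ an edge of $H$. For $W\subseteq[n]$ let $G_1,\dots,G_c$ be the connected components of the induced subgraph of $G$ on $[n]\setminus W$, let $\tilde G_k$ be the complete graph on the vertex set of $G_k$, and put $$P_W(G)=(x_i,y_i : i\in W)+J_{\tilde G_1}+\dots+J_{\tilde G_c}.$$ A non-empty set $W\subseteq[n]$ is called a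 cut set of $G$ if $P_W(G)$ is a minimal prime ideal of $J_G$. Let $W\subseteq [n]$ be non-empty. Then the following are equivalent: (a) $W$ is a cut set of $G$; (b) $W=W_{j_1}\cup\dots\cup W_{j_t}$ for some $t\ge1$ and $1\le j_1<\dots<j_t\le r-1$ with $\max W_{j_i}+1<\min W_{j_{i+1}}$ for $1\le i\le t-1$. Moreover, if $W$ is written as in (b), then the Krull dimension of $S/P_W(G)$ satisfies $\dim S/P_W(G)\le n+1$, with equality if and only if $|W_{j_i}|=1$ for every $1\le i\le t$. -/

import Mathlib

open scoped Finset

namespace BinomialEdge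

/-- The polynomial ring `S = K[x_1, …, x_n, y_1, …, y_n]`. The vertex set `[n]` is `Fin n`. -/
abbrev PolyRing (K : Type*) [Field K] (n : ℕ) : Type _ := MvPolynomial (Fin n ⊕ Fin n) K

section Ideals

variable (K : Type*) [Field K] {n : ℕ}

/-- The variable `x_i`. -/
noncomputable def x (i : Fin n) : PolyRing K n := MvPolynomial.X (Sum.inl i)

/-- The variable `y_i`. -/
noncomputable def y (i : Fin n) : PolyRing K n := MvPolynomial.X (Sum.inr i)

/-- The binomial edge ideal `J_G`, generated by the binomials `x_i y_j - x_j y_i` with `i < j`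
and `{i, j}` an edge of `G`. -/
noncomputable def binomialEdgeIdeal (G : SimpleGraph (Fin n)) : Ideal (PolyRing K n) :=
  Ideal.span {f | ∃ i j : Fin n, i < j ∧ G.Adj i j ∧ f = x K i * y K j - x K j * y K i}

/-- The edges of the complete graph on the vertex set `U ⊆ [n]`, regarded as a graph on `[n]`
(the vertices outside `U` are isolated, which does not affect the binomial edge ideal in `S`). -/
def completeOn (U : Set (Fin n)) : SimpleGraph (Fin n) where
  Adj i j := i ≠ j ∧ i ∈ U ∧ j ∈ U
  symm := ⟨fun _ _ h => ⟨h.1.symm, h.2.2, h.2.1⟩⟩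
  loopless := ⟨fun _ h => h.1 rfl⟩

/-- The ideal `P_W(G) = (x_i, y_i : i ∈ W) + J_{G̃_1} + ⋯ + J_{G̃_c}`, where `G_1, …, G_c` are the
connected components of `G ∖ W` and `G̃_k` is the complete graph on the vertex set of `G_k`. -/
noncomputable def primeP (G : SimpleGraph (Fin n)) (W : Finset (Fin n)) : Ideal (PolyRing K n) :=
  Ideal.span {f | ∃ i ∈ W, f = x K i ∨ f = y K i} ⊔
    ⨆ C : (G.induce {v : Fin n | v ∉ W}).ConnectedComponent,
      binomialEdgeIdeal K (completeOn (Subtype.val '' C.supp))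

/-- A cut set of `G`: a non-empty `W ⊆ [n]` such that `P_W(G)` is a minimal prime of `J_G`. -/
def IsCutSet (G : SimpleGraph (Fin n)) (W : Finset (Fin n)) : Prop :=
  W.Nonempty ∧ primeP K G W ∈ (binomialEdgeIdeal K G).minimalPrimes

end Ideals

/-- `G` is closed (with respect to the labelling of its vertices by `1, …, n`): for edges
`{i, j}`, `{k, l}` with `i < j` and `k < l`, if `i = k` and `j ≠ l` then `{j, l}` is an edge, and
if `j = l` and `i ≠ k` then `{i, k}` is an edge. -/
def IsClosedGraph {n : ℕ} (G : SimpleGraph (Fin n)) : Prop :=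
  ∀ i j k l : Fin n, i < j → k < l → G.Adj i j → G.Adj k l →
    (i = k → j ≠ l → G.Adj j l) ∧ (j = l → i ≠ k → G.Adj i k)

/-- `F_0, …, F_r` are all the facets of the clique complex of `G` (that is, the maximal cliques
of `G`), listed by strictly increasing minimum. For a connected closed graph the facets are
intervals `[a_i, b_i]`, so this is the list with `a_0 < ⋯ < a_r`. -/
def IsFacetList {n r : ℕ} (G : SimpleGraph (Fin n)) (F : Fin (r + 1) → Finset (Fin n)) : Prop :=
  (∀ s : Finset (Fin n),
      (∃ i, F i = s) ↔ Maximal (fun u : Finset (Fin n) => G.IsClique (u : Set (Fin n))) s) ∧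
    StrictMono fun i => (F i).min

/-- The connected cut set given by two consecutive facets `F_i` and `F_{i+1}`. -/
def connCutSet {n r : ℕ} (F : Fin (r + 1) → Finset (Fin n)) (i : Fin r) : Finset (Fin n) :=
  F i.castSucc ∩ F i.succ

/-- `W = W_{j_1} ∪ ⋯ ∪ W_{j_t}` with `j_1 < ⋯ < j_t` and
`max W_{j_i} + 1 < min W_{j_{i+1}}` for all consecutive indices, written elementwise. -/
def IsDecomposition {n r : ℕ} (F : Fin (r + 1) → Finset (Fin n)) (W : Finset (Fin n))
    {t : ℕ} (j : Fin t → Fin r) : Prop :=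
  StrictMono j ∧ W = Finset.univ.biUnion (fun i => connCutSet F (j i)) ∧
    ∀ i k : Fin t, (i : ℕ) + 1 = k →
      ∀ u ∈ connCutSet F (j i), ∀ v ∈ connCutSet F (j k), (u : ℕ) + 1 < v

end BinomialEdge

/-! The algebra reduces to counting components. Send `x_i`, `y_i` to 0 for `i ∈ W`, and otherwise to
`z_i` and `z_i q_C`, with `C` the component of `i` in `G ∖ W`. The kernel is `P_W(G)`
(`primeP_eq_ker`): the binomials move `y`-exponents freely within a component, so monomials with
equal image agree modulo `P_W(G)`. Hence `P_W(G)` is prime, and the quotient has dimension `n - |W|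
+ c(W)`, the transcendence degree of the image, where `c(W)` is the number of components.

Minimality over `J_G` becomes local: every `w ∈ W` must have neighbours in two different components
of `G ∖ W` (`isCutSet_iff`).

For a connected closed graph, `W_i` is an interval `[lo i, hi i]`, and `p < q` are non-adjacent
exactly when some such interval lies strictly between them (`exists_isSeparatorSystem`). Under the
local condition each maximal run of `W` is one of these intervals (`exists_separator`); conversely,
`t` such intervals separated by gaps satisfy it and leave `t + 1` components. The dimension is then
`n + 1 + t - |W|`, and `|W| ≥ t` with equality only for singletons. -/

namespace BinomialEdge

/-! ### Exchanging exponents within a colour class -/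

section Swap

variable {ι C R : Type*} [Fintype ι] [CommRing R]

theorem prod_pow_mul_prod_pow_eq_of_sum_eq [DecidableEq C] (c : ι → C) (X Y : ι → R)
    (h : ∀ i j, c i = c j → X i * Y j = X j * Y i) (a b a' b' : ι → ℕ)
    (hab : ∀ i, a i + b i = a' i + b' i)
    (hb : ∀ k, ∑ i with c i = k, b i = ∑ i with c i = k, b' i) :
    (∏ i, X i ^ a i) * ∏ i, Y i ^ b i = (∏ i, X i ^ a' i) * ∏ i, Y i ^ b' i := by
  classical
  induction hN : ∑ i, (b i - b' i) using Nat.strong_induction_on generalizing a b with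
  -- Induction on the total excess of `b` over `b'`; the truncated subtraction counts only indices
  -- where `b` is too large.
  | _ N ih =>
    by_cases hle : ∀ i, b i ≤ b' i
    · have hbb : ∀ i, b i = b' i := fun i =>
        (Finset.sum_eq_sum_iff_of_le (fun i _ => hle i)).1 (hb (c i)) i (by simp)
      have haa : ∀ i, a i = a' i := fun i => by have := hab i; have := hbb i; omega
      simp [hbb, haa]
    · push Not at hle
      obtain ⟨i, hi⟩ := hle
      obtain ⟨j, hcj, hj⟩ : ∃ j, c j = c i ∧ b j < b' j := by
        by_contra! hcon
        have := Finset.sum_lt_sum (s := Finset.univ.filter fun j => c j = c i) (f := b') (g := b)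
          (fun j hj => hcon j (by simpa using hj)) ⟨i, by simp, hi⟩
        rw [hb] at this
        exact lt_irrefl _ this
      have hij : i ≠ j := by rintro rfl; omega
      have haj : 0 < a j := by have := hab j; omega
      -- One exchange `X j * Y i = X i * Y j` moves a unit of `Y`-exponent from `i`, where there is
      -- too much, to `j` in the same class, where there is too little.
      let a₁ : ι → ℕ := Function.update a j (a j - 1) + Pi.single i 1
      let b₁ : ι → ℕ := Function.update b i (b i - 1) + Pi.single j 1
      have hprodX : ∏ k, X k ^ a k =
          X j * ∏ k, X k ^ (Function.update a j (a j - 1)) k := by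
        rw [← Finset.mul_prod_erase _ _ (Finset.mem_univ j),
          ← Finset.mul_prod_erase _ (fun k => X k ^ (Function.update a j (a j - 1)) k)
            (Finset.mem_univ j)]
        rw [← mul_assoc, Function.update_self, ← pow_succ', Nat.sub_add_cancel haj]
        congr 1
        refine Finset.prod_congr rfl fun k hk => ?_
        rw [Function.update_of_ne (Finset.ne_of_mem_erase hk)]
      have hprodY : ∏ k, Y k ^ b k =
          Y i * ∏ k, Y k ^ (Function.update b i (b i - 1)) k := by
        rw [← Finset.mul_prod_erase _ _ (Finset.mem_univ i),
          ← Finset.mul_prod_erase _ (fun k => Y k ^ (Function.update b i (b i - 1)) k)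
            (Finset.mem_univ i)]
        rw [← mul_assoc, Function.update_self, ← pow_succ', Nat.sub_add_cancel (by omega)]
        congr 1
        refine Finset.prod_congr rfl fun k hk => ?_
        rw [Function.update_of_ne (Finset.ne_of_mem_erase hk)]
      have hprodX' : ∏ k, X k ^ a₁ k =
          X i * ∏ k, X k ^ (Function.update a j (a j - 1)) k := by
        simp only [a₁, Pi.add_apply, pow_add, Finset.prod_mul_distrib]
        rw [mul_comm]
        congr 1
        rw [Finset.prod_eq_single i] <;> simp +contextual
      have hprodY' : ∏ k, Y k ^ b₁ k =
          Y j * ∏ k, Y k ^ (Function.update b i (b i - 1)) k := by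
        simp only [b₁, Pi.add_apply, pow_add, Finset.prod_mul_distrib]
        rw [mul_comm]
        congr 1
        rw [Finset.prod_eq_single j] <;> simp +contextual
      have hupd : ∀ k, b₁ k + (if k = i then 1 else 0)
          = b k + if k = j then 1 else 0 := by
        intro k
        by_cases hki : k = i
        · subst hki; simp [b₁, hij]; omega
        · by_cases hkj : k = j
          · subst hkj; simp [b₁, hki]
          · simp [b₁, hki, hkj]
      have hupda : ∀ k, a₁ k + (if k = j then 1 else 0)
          = a k + if k = i then 1 else 0 := by
        intro k
        by_cases hki : k = j
        · subst hki; simp [a₁, hij.symm]; omega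
        · by_cases hkj : k = i
          · subst hkj; simp [a₁, hki]
          · simp [a₁, hki, hkj]
      have key := ih (∑ k, (b₁ k - b' k)) (by
          rw [← hN]
          refine Finset.sum_lt_sum (fun k _ => ?_) ⟨i, Finset.mem_univ _, ?_⟩
          · have := hupd k
            by_cases hkj : k = j
            · subst hkj
              simp [hij.symm] at this ⊢
              omega
            · simp only [hkj, if_false] at this
              omega
          · have := hupd i
            simp only [hij, if_true, if_false] at this
            omega)
        a₁ b₁
        (fun k => by have := hupd k; have := hupda k; have := hab k; omega)
        (fun k => by
          rw [← hb k]
          have := Finset.sum_congr (rfl : (Finset.univ.filter fun i => c i = k) = _)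
            (fun l _ => hupd l)
          rw [Finset.sum_add_distrib, Finset.sum_add_distrib] at this
          simp only [Finset.sum_ite_eq', Finset.mem_filter, Finset.mem_univ, true_and, hcj] at this
          omega) rfl
      rw [← key, hprodX, hprodY, hprodX', hprodY']
      linear_combination (∏ k, X k ^ (Function.update a j (a j - 1)) k) *
        (∏ k, Y k ^ (Function.update b i (b i - 1)) k) * h j i hcj

end Swap

/-! ### Kernel of the monomial parametrization -/

section Param

open MvPolynomial

variable (K : Type*) [Field K] {ι C : Type*} (c : ι → C)

/-- The monomial parametrization `x_i ↦ z_i`, `y_i ↦ z_i q_{c i}` attached to a colouring `c`. -/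
noncomputable def colorMap : MvPolynomial (ι ⊕ ι) K →ₐ[K] MvPolynomial (ι ⊕ C) K :=
  aeval (Sum.elim (fun i => X (Sum.inl i)) fun i => X (Sum.inl i) * X (Sum.inr (c i)))

variable [Fintype ι] [Fintype C] [DecidableEq C]

/-- The exponent of the image of a monomial under `colorMap`. -/
noncomputable def colorExp (m : ι ⊕ ι →₀ ℕ) : ι ⊕ C →₀ ℕ :=
  Finsupp.equivFunOnFinite.symm
    (Sum.elim (fun i => m (Sum.inl i) + m (Sum.inr i)) fun k => ∑ i with c i = k, m (Sum.inr i))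

theorem colorMap_monomial (m : ι ⊕ ι →₀ ℕ) :
    colorMap K c (monomial m 1) = monomial (colorExp c m) 1 := by
  rw [colorMap, aeval_monomial, monomial_eq, Finsupp.prod_fintype _ _ (by simp),
    Finsupp.prod_fintype _ _ (by simp)]
  simp only [map_one, one_mul, Fintype.prod_sum_type, Sum.elim_inl, Sum.elim_inr, colorExp,
    Finsupp.equivFunOnFinite_symm_apply_apply, mul_pow, pow_add, Finset.prod_mul_distrib, mul_assoc]
  congr 2
  rw [← Finset.prod_fiberwise Finset.univ c]
  refine Finset.prod_congr rfl fun k _ => ?_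
  rw [← Finset.prod_pow_eq_pow_sum]
  refine Finset.prod_congr rfl fun i hi => ?_
  rw [(Finset.mem_filter.1 hi).2]

/-- Monomials with the same image take the same value, by exchanging exponents, so evaluation
factors through `colorMap` as a `K`-linear map; linearity suffices. -/
theorem aeval_eq_zero_of_colorMap_eq_zero {R : Type*} [CommRing R] [Algebra K R] (X Y : ι → R)
    (h : ∀ i j, c i = c j → X i * Y j = X j * Y i) (f : MvPolynomial (ι ⊕ ι) K)
    (hf : colorMap K c f = 0) : aeval (Sum.elim X Y) f = 0 := by
  classical
  -- Chosen preimages define `ψ` on image monomials; the value 0 elsewhere is arbitrary.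
  let ψ : MvPolynomial (ι ⊕ C) K →ₗ[K] R := (basisMonomials (ι ⊕ C) K).constr K fun μ =>
    if h : ∃ m : ι ⊕ ι →₀ ℕ, colorExp c m = μ then
      aeval (Sum.elim X Y) (monomial h.choose (1 : K)) else 0
  have hψ : ψ ∘ₗ (colorMap K c).toLinearMap = (aeval (Sum.elim X Y)).toLinearMap := by
    refine (basisMonomials (ι ⊕ ι) K).ext fun m => ?_
    have hex : ∃ m', colorExp c m' = colorExp c m := ⟨m, rfl⟩
    have h1 : ψ (monomial (colorExp c m) 1) =
        aeval (Sum.elim X Y) (monomial hex.choose (1 : K)) := by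
      have := (basisMonomials (ι ⊕ C) K).constr_basis K (fun μ =>
        if h : ∃ m : ι ⊕ ι →₀ ℕ, colorExp c m = μ then
          aeval (Sum.elim X Y) (monomial h.choose (1 : K)) else 0) (colorExp c m)
      rw [dif_pos hex, coe_basisMonomials] at this
      exact this
    simp only [coe_basisMonomials, LinearMap.comp_apply, AlgHom.toLinearMap_apply,
      colorMap_monomial]
    rw [h1]
    have hs := hex.choose_spec
    generalize hex.choose = m' at hs
    rw [aeval_monomial, aeval_monomial, Finsupp.prod_fintype _ _ (by simp),
      Finsupp.prod_fintype _ _ (by simp)]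
    simp only [Fintype.prod_sum_type, Sum.elim_inl, Sum.elim_inr]
    rw [prod_pow_mul_prod_pow_eq_of_sum_eq c X Y h]
    · intro i
      simpa [colorExp] using DFunLike.congr_fun hs (Sum.inl i)
    · intro k
      simpa [colorExp] using DFunLike.congr_fun hs (Sum.inr k)
  have := LinearMap.congr_fun hψ f
  simp only [LinearMap.comp_apply, AlgHom.toLinearMap_apply, hf, map_zero] at this
  exact this.symm

end Param

/-! ### Krull dimension and transcendence degree -/

section Dimension

theorem ringKrullDim_le_of_isIntegral {R S : Type*} [CommRing R] [CommRing S] [Algebra R S]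
    [Algebra.IsIntegral R S] : ringKrullDim S ≤ ringKrullDim R := by
  refine Order.krullDim_le_of_strictMono (fun p => PrimeSpectrum.comap (algebraMap R S) p) ?_
  intro p q hpq
  exact Ideal.IsIntegral.comap_lt_comap (R := R) hpq

theorem ringKrullDim_le_of_isIntegral_of_injective {R S : Type*} [CommRing R] [CommRing S]
    [Algebra R S] [Algebra.IsIntegral R S] (hinj : Function.Injective (algebraMap R S)) :
    ringKrullDim R ≤ ringKrullDim S := by
  -- Recording that the last prime lies over `l.last` lets going-up extend the lifted chain.
  have key : ∀ l : LTSeries (PrimeSpectrum R), ∃ l' : LTSeries (PrimeSpectrum S),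
      l'.length = l.length ∧ PrimeSpectrum.comap (algebraMap R S) l'.last = l.last := by
    intro l
    induction l using RelSeries.inductionOn' with
    | singleton p =>
      obtain ⟨Q, -, hQ, hQp⟩ := Ideal.exists_ideal_over_prime_of_isIntegral (S := S) p.asIdeal ⊥ (by
        intro x hx
        rw [Ideal.mem_comap, Ideal.mem_bot] at hx
        rw [(injective_iff_map_eq_zero _).1 hinj x hx]
        exact zero_mem _)
      exact ⟨RelSeries.singleton _ ⟨Q, hQ⟩, rfl, PrimeSpectrum.ext hQp⟩
    | snoc l p hp ih =>
      obtain ⟨l', hlen, hlast⟩ := ih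
      have hlt : l.last < p := hp
      obtain ⟨Q, hQle, hQ, hQp⟩ := Ideal.exists_ideal_over_prime_of_isIntegral (S := S) p.asIdeal
        l'.last.asIdeal (by
          have := congrArg PrimeSpectrum.asIdeal hlast
          exact (le_of_eq this).trans hlt.le)
      have hlt' : l'.last < ⟨Q, hQ⟩ := by
        refine lt_of_le_of_ne hQle ?_
        intro h
        rw [h] at hlast
        exact hlt.ne (hlast.symm.trans (PrimeSpectrum.ext hQp))
      exact ⟨l'.snoc ⟨Q, hQ⟩ hlt', by simpa using hlen, by simpa using PrimeSpectrum.ext hQp⟩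
  refine iSup_le fun l => ?_
  obtain ⟨l', hlen, -⟩ := key l
  rw [← hlen]
  exact Order.LTSeries.length_le_krullDim l'

theorem ringKrullDim_eq_of_isIntegral_of_injective {R S : Type*} [CommRing R] [CommRing S]
    [Algebra R S] [Algebra.IsIntegral R S] (hinj : Function.Injective (algebraMap R S)) :
    ringKrullDim S = ringKrullDim R :=
  ringKrullDim_le_of_isIntegral.antisymm (ringKrullDim_le_of_isIntegral_of_injective hinj)

/-- The Krull dimension of an affine domain is its transcendence degree. -/
theorem ringKrullDim_eq_of_trdeg_eq (K : Type*) {A : Type*} [Field K] [CommRing A] [IsDomain A]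
    [Algebra K A] [Algebra.FiniteType K A] {d : ℕ} (hd : Algebra.trdeg K A = d) :
    ringKrullDim A = d := by
  -- Noether normalization; additivity of transcendence degree gives `s = d`.
  obtain ⟨s, g, hinj, hint⟩ := exists_integral_inj_algHom_of_fg K A
  let _ : Algebra (MvPolynomial (Fin s) K) A := g.toRingHom.toAlgebra
  have : IsScalarTower K (MvPolynomial (Fin s) K) A :=
    IsScalarTower.of_algebraMap_eq fun r => (g.commutes r).symm
  have : Algebra.IsIntegral (MvPolynomial (Fin s) K) A := ⟨hint⟩
  have : FaithfulSMul (MvPolynomial (Fin s) K) A :=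
    (faithfulSMul_iff_algebraMap_injective _ _).2 hinj
  have h := lift_trdeg_add_eq K (MvPolynomial (Fin s) K) A
  rw [trdeg_eq_zero (R := MvPolynomial (Fin s) K) (A := A), hd,
    MvPolynomial.trdeg_of_isDomain] at h
  have hs : s = d := by simpa using h
  rw [ringKrullDim_eq_of_isIntegral_of_injective (R := MvPolynomial (Fin s) K) (S := A) hinj,
    MvPolynomial.ringKrullDim_of_isNoetherianRing, ringKrullDim_eq_zero_of_field]
  simp [hs]

end Dimension

/-! ### Dimension of the image of the parametrization -/

section Param

open MvPolynomial

variable (K : Type*) [Field K] {ι C : Type*} [Fintype ι] [Fintype C] (c : ι → C)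

theorem trdeg_range_colorMap (hc : Function.Surjective c) :
    Algebra.trdeg K (colorMap K c).range = (Fintype.card ι + Fintype.card C : ℕ) := by
  have halg : Algebra.IsAlgebraic (colorMap K c).range (MvPolynomial (ι ⊕ C) K) := by
    have hz : ∀ i, (X (Sum.inl i) : MvPolynomial (ι ⊕ C) K) ∈ (colorMap K c).range := fun i =>
      ⟨X (Sum.inl i), by simp [colorMap]⟩
    have hzq : ∀ i, (X (Sum.inl i) * X (Sum.inr (c i)) : MvPolynomial (ι ⊕ C) K) ∈
        (colorMap K c).range := fun i => ⟨X (Sum.inr i), by simp [colorMap]⟩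
    refine ⟨fun p => ?_⟩
    induction p using MvPolynomial.induction_on with
    | C a =>
      exact isAlgebraic_algebraMap
        (⟨MvPolynomial.C a, ⟨MvPolynomial.C a, by simp [colorMap]⟩⟩ : (colorMap K c).range)
    | add p q hp hq => exact hp.add hq
    | mul_X p s hp =>
      refine hp.mul ?_
      rcases s with i | k
      · exact isAlgebraic_algebraMap (⟨_, hz i⟩ : (colorMap K c).range)
      · obtain ⟨i, rfl⟩ := hc k
        -- `q_{c i}` is a root of `z_i T - z_i q_{c i}`, whose coefficients lie in the image.
        refine ⟨Polynomial.C ⟨_, hz i⟩ * Polynomial.X - Polynomial.C ⟨_, hzq i⟩, ?_, ?_⟩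
        · intro h
          have := congrArg (fun p => Polynomial.coeff p 1) h
          simp only [Polynomial.coeff_sub, Polynomial.coeff_C_mul, Polynomial.coeff_X_one, mul_one,
            Polynomial.coeff_C, one_ne_zero, if_false, sub_zero, Polynomial.coeff_zero] at this
          exact X_ne_zero (R := K) (Sum.inl i : ι ⊕ C) (congrArg Subtype.val this)
        · simp [Algebra.algebraMap_eq_smul_one, Subalgebra.smul_def]
  have h := trdeg_add_eq K (colorMap K c).range (A := MvPolynomial (ι ⊕ C) K)
  rw [trdeg_eq_zero (R := (colorMap K c).range), MvPolynomial.trdeg_of_isDomain,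
    add_zero] at h
  rw [h]
  simp

theorem ringKrullDim_range_colorMap (hc : Function.Surjective c) :
    ringKrullDim (colorMap K c).range = (Fintype.card ι + Fintype.card C : ℕ) := by
  have : Algebra.FiniteType K (colorMap K c).range :=
    Algebra.FiniteType.of_surjective (colorMap K c).rangeRestrict
      (colorMap K c).rangeRestrict_surjective
  exact ringKrullDim_eq_of_trdeg_eq K (trdeg_range_colorMap K c hc)

end Param

/-! ### Minors of a `2 × 3` matrix modulo a prime -/

section Minors

variable {R : Type*} [CommRing R] {I : Ideal R} {a b c d e f : R}

theorem minor_mem_of_mem_left (ha : a ∈ I) (hb : b ∈ I) : a * d - c * b ∈ I :=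
  I.sub_mem (I.mul_mem_right _ ha) (I.mul_mem_left _ hb)

theorem minor_mem_of_mem_right (hc : c ∈ I) (hd : d ∈ I) : a * d - c * b ∈ I :=
  I.sub_mem (I.mul_mem_left _ hd) (I.mul_mem_right _ hc)

/-- Modulo `I`, a column proportional to two independent columns vanishes. -/
theorem mem_of_minors_mem [hI : I.IsPrime] (hab : a * d - c * b ∈ I) (haf : a * f - e * b ∈ I)
    (hcf : c * f - e * d ∉ I) : a ∈ I ∧ b ∈ I := by
  constructor
  · refine (hI.mem_or_mem (y := c * f - e * d) ?_).resolve_right hcf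
    have : a * (c * f - e * d) = c * (a * f - e * b) - e * (a * d - c * b) := by ring
    rw [this]
    exact I.sub_mem (I.mul_mem_left _ haf) (I.mul_mem_left _ hab)
  · refine (hI.mem_or_mem (y := c * f - e * d) ?_).resolve_right hcf
    have : b * (c * f - e * d) = d * (a * f - e * b) - f * (a * d - c * b) := by ring
    rw [this]
    exact I.sub_mem (I.mul_mem_left _ haf) (I.mul_mem_left _ hab)

/-- Proportionality of columns is transitive through a middle column that is nonzero modulo `I`. -/
theorem minor_mem_trans [hI : I.IsPrime] (hc : c ∉ I) (hab : a * d - c * b ∈ I)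
    (hcf : c * f - e * d ∈ I) : a * f - e * b ∈ I := by
  refine (hI.mem_or_mem (x := c) ?_).resolve_left hc
  have : c * (a * f - e * b) = a * (c * f - e * d) + e * (a * d - c * b) := by ring
  rw [this]
  exact I.add_mem (I.mul_mem_left _ hcf) (I.mul_mem_left _ hab)

end Minors

/-! ### The primes `P_W(G)` and the local minimality criterion -/

section PrimeP

open MvPolynomial

variable (K : Type*) [Field K] {n : ℕ} (G : SimpleGraph (Fin n)) (W : Finset (Fin n))

/-- The graph `G ∖ W`. -/
abbrev deleted : SimpleGraph {v : Fin n | v ∉ W} := G.induce {v : Fin n | v ∉ W}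

variable {G W} in
theorem x_mem_primeP {i : Fin n} (hi : i ∈ W) : x K i ∈ primeP K G W :=
  Ideal.mem_sup_left (Ideal.subset_span ⟨i, hi, Or.inl rfl⟩)

variable {G W} in
theorem y_mem_primeP {i : Fin n} (hi : i ∈ W) : y K i ∈ primeP K G W :=
  Ideal.mem_sup_left (Ideal.subset_span ⟨i, hi, Or.inr rfl⟩)

variable {G W} in
theorem binomial_mem_primeP {i j : {v : Fin n | v ∉ W}} (hij : (deleted G W).Reachable i j) :
    x K (i : Fin n) * y K j - x K j * y K i ∈ primeP K G W := by
  have key : ∀ i j : {v : Fin n | v ∉ W}, (deleted G W).Reachable i j → (i : Fin n) < j →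
      x K (i : Fin n) * y K j - x K j * y K i ∈ primeP K G W := by
    intro i j hij hlt
    refine Ideal.mem_sup_right (Ideal.mem_iSup_of_mem ((deleted G W).connectedComponentMk j)
      (Ideal.subset_span ⟨i, j, hlt, ⟨hlt.ne, ⟨i, ?_, rfl⟩, ⟨j, ?_, rfl⟩⟩, rfl⟩))
    · simpa using hij
    · simp
  rcases lt_trichotomy (i : Fin n) j with h | h | h
  · exact key i j hij h
  · rw [h, sub_self]; exact zero_mem _
  · rw [← neg_sub]
    exact neg_mem (key j i hij.symm h)

variable {K G W} in
theorem primeP_le_iff {I : Ideal (PolyRing K n)} : primeP K G W ≤ I ↔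
    (∀ i ∈ W, x K i ∈ I ∧ y K i ∈ I) ∧ ∀ i j : {v : Fin n | v ∉ W}, (deleted G W).Reachable i j →
      x K (i : Fin n) * y K j - x K j * y K i ∈ I := by
  constructor
  · intro h
    exact ⟨fun i hi => ⟨h (x_mem_primeP K hi), h (y_mem_primeP K hi)⟩,
      fun i j hij => h (binomial_mem_primeP K hij)⟩
  · rintro ⟨h1, h2⟩
    refine sup_le (Ideal.span_le.2 ?_) (iSup_le fun C => Ideal.span_le.2 ?_)
    · rintro f ⟨i, hi, rfl | rfl⟩
      exacts [(h1 i hi).1, (h1 i hi).2]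
    · rintro f ⟨i, j, -, ⟨-, ⟨i, hi, rfl⟩, ⟨j, hj, rfl⟩⟩, rfl⟩
      refine h2 i j ?_
      rw [SimpleGraph.ConnectedComponent.mem_supp_iff] at hi hj
      exact SimpleGraph.ConnectedComponent.exact (hi.trans hj.symm)

theorem binomialEdgeIdeal_le_primeP : binomialEdgeIdeal K G ≤ primeP K G W := by
  refine Ideal.span_le.2 ?_
  rintro f ⟨i, j, hlt, hij, rfl⟩
  by_cases hi : i ∈ W
  · exact minor_mem_of_mem_left (x_mem_primeP K hi) (y_mem_primeP K hi)
  by_cases hj : j ∈ W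
  · exact minor_mem_of_mem_right (x_mem_primeP K hj) (y_mem_primeP K hj)
  exact binomial_mem_primeP K (i := ⟨i, hi⟩) (j := ⟨j, hj⟩) (SimpleGraph.Adj.reachable (by simpa))

theorem binomial_mem_binomialEdgeIdeal {i j : Fin n} (h : G.Adj i j) :
    x K i * y K j - x K j * y K i ∈ binomialEdgeIdeal K G := by
  rcases lt_or_gt_of_ne h.ne with hlt | hlt
  · exact Ideal.subset_span ⟨i, j, hlt, h, rfl⟩
  · rw [← neg_sub]
    exact neg_mem (Ideal.subset_span ⟨j, i, hlt, h.symm, rfl⟩)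

/-- The specialization setting the variables with index in `W` to zero. -/
noncomputable def killMap : PolyRing K n →ₐ[K]
    MvPolynomial ({v : Fin n | v ∉ W} ⊕ {v : Fin n | v ∉ W}) K :=
  aeval (Sum.elim (fun i => if h : i ∉ W then X (Sum.inl ⟨i, h⟩) else 0)
    fun i => if h : i ∉ W then X (Sum.inr ⟨i, h⟩) else 0)

/-- The parametrization of the variety of `P_W(G)`. -/
noncomputable def paramMap : PolyRing K n →ₐ[K]
    MvPolynomial ({v : Fin n | v ∉ W} ⊕ (deleted G W).ConnectedComponent) K :=
  (colorMap K (deleted G W).connectedComponentMk).comp (killMap K W)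

variable {W} in
theorem paramMap_x_of_notMem {i : Fin n} (hi : i ∉ W) :
    paramMap K G W (x K i) = X (Sum.inl ⟨i, hi⟩) := by
  simp [paramMap, killMap, x, hi, colorMap]

variable {W} in
theorem paramMap_y_of_notMem {i : Fin n} (hi : i ∉ W) :
    paramMap K G W (y K i) = X (Sum.inl ⟨i, hi⟩) *
      X (Sum.inr ((deleted G W).connectedComponentMk ⟨i, hi⟩)) := by
  simp [paramMap, killMap, y, hi, colorMap]

theorem killMap_surjective : Function.Surjective (killMap K W) := by
  rw [← AlgHom.range_eq_top, eq_top_iff, ← MvPolynomial.adjoin_range_X, Algebra.adjoin_le_iff]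
  rintro _ ⟨i | i, rfl⟩
  · exact ⟨x K i, by simp [killMap, x, show (i : Fin n) ∉ W from i.2]⟩
  · exact ⟨y K i, by simp [killMap, y, show (i : Fin n) ∉ W from i.2]⟩

theorem range_paramMap : (paramMap K G W).range =
    (colorMap K (deleted G W).connectedComponentMk).range := by
  rw [paramMap, AlgHom.range_comp, (AlgHom.range_eq_top _).2 (killMap_surjective K W),
    Algebra.map_top]

theorem primeP_eq_ker : primeP K G W = RingHom.ker (paramMap K G W) := by
  classical
  have : Fintype (deleted G W).ConnectedComponent := Fintype.ofFinite _
  refine le_antisymm (primeP_le_iff.2 ⟨fun i hi => ?_, fun i j hij => ?_⟩) fun f hf => ?_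
  · simp [RingHom.mem_ker, paramMap, killMap, x, y, hi]
  · rw [RingHom.mem_ker, map_sub, map_mul, map_mul, paramMap_x_of_notMem K G i.2,
      paramMap_x_of_notMem K G j.2, paramMap_y_of_notMem K G i.2, paramMap_y_of_notMem K G j.2,
      SimpleGraph.ConnectedComponent.sound hij]
    ring
  · rw [RingHom.mem_ker] at hf
    let X' : {v : Fin n | v ∉ W} → PolyRing K n ⧸ primeP K G W := fun i =>
      Ideal.Quotient.mk _ (x K (i : Fin n))
    let Y' : {v : Fin n | v ∉ W} → PolyRing K n ⧸ primeP K G W := fun i =>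
      Ideal.Quotient.mk _ (y K (i : Fin n))
    have h0 := aeval_eq_zero_of_colorMap_eq_zero K (deleted G W).connectedComponentMk X' Y'
      (fun i j hij => by
        rw [← sub_eq_zero, ← map_mul, ← map_mul, ← map_sub, Ideal.Quotient.eq_zero_iff_mem]
        exact binomial_mem_primeP K (SimpleGraph.ConnectedComponent.exact hij)) (killMap K W f) hf
    -- Evaluating at the residue classes after `killMap` is the quotient map, so an element of the
    -- kernel has class zero.
    have hcomp : (aeval (Sum.elim X' Y')).comp (killMap K W) =
        Ideal.Quotient.mkₐ K (primeP K G W) := by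
      refine MvPolynomial.algHom_ext fun s => ?_
      rcases s with i | i
      · by_cases hi : i ∈ W
        · simpa [killMap, hi, x] using
            (Ideal.Quotient.eq_zero_iff_mem.2 (x_mem_primeP K (G := G) hi)).symm
        · simp [killMap, hi, X', x]
      · by_cases hi : i ∈ W
        · simpa [killMap, hi, y] using
            (Ideal.Quotient.eq_zero_iff_mem.2 (y_mem_primeP K (G := G) hi)).symm
        · simp [killMap, hi, Y', y]
    rw [← Ideal.Quotient.eq_zero_iff_mem]
    exact (DFunLike.congr_fun hcomp f).symm.trans h0

theorem primeP_isPrime : (primeP K G W).IsPrime := by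
  rw [primeP_eq_ker]
  exact RingHom.ker_isPrime _

theorem ringKrullDim_quotient_primeP : ringKrullDim (PolyRing K n ⧸ primeP K G W) =
    (n - #W + Nat.card (deleted G W).ConnectedComponent : ℕ) := by
  classical
  have : Fintype (deleted G W).ConnectedComponent := Fintype.ofFinite _
  have hcard : Fintype.card {v : Fin n | v ∉ W} = n - #W := by
    have : Fintype.card {v : Fin n // ¬ v ∈ W} = n - #W := by
      rw [Fintype.card_subtype_compl, Fintype.card_fin, Fintype.card_coe]
    exact (Fintype.card_congr (Equiv.refl _)).trans this
  have hsurj : Function.Surjective (deleted G W).connectedComponentMk := Quot.mk_surjective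
  rw [primeP_eq_ker, ← AlgHom.ker_rangeRestrict, ringKrullDim_eq_of_ringEquiv
    (Ideal.quotientKerAlgEquivOfSurjective (paramMap K G W).rangeRestrict_surjective).toRingEquiv,
    range_paramMap, ringKrullDim_range_colorMap K _ hsurj, hcard,
    Nat.card_eq_fintype_card]

variable {K G W}

theorem x_notMem_primeP {i : Fin n} (hi : i ∉ W) : x K i ∉ primeP K G W := by
  rw [primeP_eq_ker, RingHom.mem_ker, paramMap_x_of_notMem K G hi]
  exact X_ne_zero _

/-- The binomial maps to `z_i z_j (q_{C(j)} - q_{C(i)})`, which vanishes only if the components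
agree. -/
theorem reachable_of_binomial_mem_primeP {i j : {v : Fin n | v ∉ W}}
    (h : x K (i : Fin n) * y K j - x K j * y K i ∈ primeP K G W) :
    (deleted G W).Reachable i j := by
  rw [primeP_eq_ker, RingHom.mem_ker, map_sub, map_mul, map_mul, paramMap_x_of_notMem K G i.2,
    paramMap_x_of_notMem K G j.2, paramMap_y_of_notMem K G i.2, paramMap_y_of_notMem K G j.2,
    sub_eq_zero, mul_left_comm, mul_right_inj' (X_ne_zero _), mul_right_inj' (X_ne_zero _)] at h
  exact SimpleGraph.ConnectedComponent.exact (Sum.inr_injective (X_injective h)).symm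

/-- Every vertex of `W` has two neighbours lying in different components of `G ∖ W`. -/
def HasCutPointProperty (G : SimpleGraph (Fin n)) (W : Finset (Fin n)) : Prop :=
  ∀ w ∈ W, ∃ p q : {v : Fin n | v ∉ W}, G.Adj w p ∧ G.Adj w q ∧ ¬ (deleted G W).Reachable p q

/-- Let `Q` be a prime between `J_G` and `P_W(G)`. The binomial of two neighbours of `w` in
different components is not in `Q`, which forces `x_w, y_w ∈ Q`. Along walks in `G ∖ W` no `x_k`
lies in `Q`, so proportionality propagates. -/
theorem primeP_mem_minimalPrimes (h : HasCutPointProperty G W) :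
    primeP K G W ∈ (binomialEdgeIdeal K G).minimalPrimes := by
  refine ⟨⟨primeP_isPrime K G W, binomialEdgeIdeal_le_primeP K G W⟩, ?_⟩
  rintro Q ⟨hQ, hJQ⟩ hQP
  have hadj : ∀ {i j : Fin n}, G.Adj i j → x K i * y K j - x K j * y K i ∈ Q := fun hij =>
    hJQ (binomial_mem_binomialEdgeIdeal K G hij)
  refine primeP_le_iff.2 ⟨fun w hw => ?_, fun i j hij => ?_⟩
  · obtain ⟨p, q, hp, hq, hpq⟩ := h w hw
    exact mem_of_minors_mem (hadj hp) (hadj hq) fun hmem =>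
      hpq (reachable_of_binomial_mem_primeP (hQP hmem))
  · obtain ⟨walk⟩ := hij
    induction walk with
    | nil => rw [sub_self]; exact zero_mem _
    | @cons i k j hik _ ih =>
      exact minor_mem_trans (fun hk => x_notMem_primeP k.2 (hQP hk)) (hadj hik) ih

/-- If all neighbours of `w` outside `W` lie in one component, restoring `w` merges no components.
Then `P_{W ∖ {w}}(G)` is a prime over `J_G` strictly inside `P_W(G)`, as it omits `x_w`. -/
theorem hasCutPointProperty_of_mem_minimalPrimes
    (h : primeP K G W ∈ (binomialEdgeIdeal K G).minimalPrimes) : HasCutPointProperty G W := by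
  intro w hw
  by_contra! hcon
  have hle : primeP K G (W.erase w) ≤ primeP K G W := by
    refine primeP_le_iff.2 ⟨fun i hi => ⟨x_mem_primeP K (Finset.mem_of_mem_erase hi),
      y_mem_primeP K (Finset.mem_of_mem_erase hi)⟩, fun ⟨i, hi'⟩ ⟨j, hj'⟩ hij => ?_⟩
    change x K i * y K j - x K j * y K i ∈ _
    by_cases hi : i ∈ W
    · exact minor_mem_of_mem_left (x_mem_primeP K hi) (y_mem_primeP K hi)
    by_cases hj : j ∈ W
    · exact minor_mem_of_mem_right (x_mem_primeP K hj) (y_mem_primeP K hj)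
    refine binomial_mem_primeP K (i := ⟨i, hi⟩) (j := ⟨j, hj⟩) ?_
    -- a walk through `w` may bypass it, since the neighbours of `w` lie in one component
    have key : ∀ k j : {v : Fin n | v ∉ W.erase w}, (deleted G (W.erase w)).Walk k j →
        ∀ hj : (j : Fin n) ∉ W,
        (∀ hk : (k : Fin n) ∉ W, (deleted G W).Reachable ⟨k, hk⟩ ⟨j, hj⟩) ∧
        ((k : Fin n) = w → ∀ p : {v : Fin n | v ∉ W}, G.Adj w p →
          (deleted G W).Reachable p ⟨j, hj⟩) := by
      intro k j walk hj
      induction walk with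
      | nil => exact ⟨fun hk => .rfl, fun hk => absurd (by rw [hk]; exact hw) hj⟩
      | @cons k l j hkl _ ih =>
        have hkl' : G.Adj k l := hkl
        obtain ⟨ih1, ih2⟩ := ih hj
        have hl : (l : Fin n) ∉ W ∨ (l : Fin n) = w := by
          have : (l : Fin n) ∉ W.erase w := l.2
          rw [Finset.mem_erase] at this
          tauto
        refine ⟨fun hk => ?_, fun hk p hp => ?_⟩
        · rcases hl with hl | hl
          · exact (SimpleGraph.Adj.reachable (G := deleted G W) (u := ⟨k, hk⟩) (v := ⟨l, hl⟩)
              hkl').trans (ih1 hl)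
          · rw [hl] at hkl'
            exact ih2 hl ⟨k, hk⟩ hkl'.symm
        · rw [hk] at hkl'
          have hl : (l : Fin n) ∉ W := hl.resolve_right hkl'.ne'
          exact (hcon p ⟨l, hl⟩ hp hkl').trans (ih1 hl)
    obtain ⟨walk⟩ := hij
    exact (key ⟨i, hi'⟩ ⟨j, hj'⟩ walk hj).1 hi
  have := h.2 ⟨primeP_isPrime K G _, binomialEdgeIdeal_le_primeP K G _⟩ hle
  exact x_notMem_primeP (Finset.notMem_erase w W) (this (x_mem_primeP K hw))

theorem isCutSet_iff (hW : W.Nonempty) : IsCutSet K G W ↔ HasCutPointProperty G W :=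
  ⟨fun h => hasCutPointProperty_of_mem_minimalPrimes h.2,
    fun h => ⟨hW, primeP_mem_minimalPrimes h⟩⟩

end PrimeP

/-! ### Adjacency in connected closed graphs -/

section Closed

variable {n : ℕ} {G : SimpleGraph (Fin n)}

theorem IsClosedGraph.adj_of_adj_left (h : IsClosedGraph G) {i j l : Fin n} (hij : i < j)
    (hil : i < l) (hjl : j ≠ l) (h1 : G.Adj i j) (h2 : G.Adj i l) : G.Adj j l :=
  (h i j i l hij hil h1 h2).1 rfl hjl

theorem IsClosedGraph.adj_of_adj_right (h : IsClosedGraph G) {i k j : Fin n} (hij : i < j)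
    (hkj : k < j) (hik : i ≠ k) (h1 : G.Adj i j) (h2 : G.Adj k j) : G.Adj i k :=
  (h i j k j hij hkj h1 h2).2 rfl hik

/-- Two vertices of a connected component of a closed graph are joined by a monotone path. -/
theorem IsClosedGraph.reflTransGen_or (h : IsClosedGraph G) {a b : Fin n} (hab : G.Reachable a b) :
    Relation.ReflTransGen (fun u v => u < v ∧ G.Adj u v) a b ∨
      Relation.ReflTransGen (fun u v => u < v ∧ G.Adj u v) b a := by
  -- Prepend an edge `c a` to an increasing path starting `a, a'`. If `a < c`, closedness at `a`
  -- gives `c = a'` or an edge `c a'`, and the argument moves along the path. `h2` is the mirror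
  -- image.
  have h1 : ∀ {a b : Fin n}, Relation.ReflTransGen (fun u v => u < v ∧ G.Adj u v) a b →
      ∀ c, G.Adj c a → Relation.ReflTransGen (fun u v => u < v ∧ G.Adj u v) c b ∨
        Relation.ReflTransGen (fun u v => u < v ∧ G.Adj u v) b c := by
    intro a b hab
    induction hab using Relation.ReflTransGen.head_induction_on with
    | refl =>
      intro c hc
      rcases lt_or_gt_of_ne hc.ne with hlt | hlt
      · exact Or.inl (.single ⟨hlt, hc⟩)
      · exact Or.inr (.single ⟨hlt, hc.symm⟩)
    | @head a a' haa' hab ih =>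
      intro c hc
      rcases lt_or_gt_of_ne hc.ne with hlt | hlt
      · exact Or.inl (.head ⟨hlt, hc⟩ (.head haa' hab))
      · by_cases hca : c = a'
        · exact Or.inl (hca ▸ hab)
        · exact ih c (h.adj_of_adj_left hlt haa'.1 hca hc.symm haa'.2)
  have h2 : ∀ {a b : Fin n}, Relation.ReflTransGen (fun u v => u < v ∧ G.Adj u v) b a →
      ∀ c, G.Adj c a → Relation.ReflTransGen (fun u v => u < v ∧ G.Adj u v) c b ∨
        Relation.ReflTransGen (fun u v => u < v ∧ G.Adj u v) b c := by
    intro a b hab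
    induction hab with
    | refl =>
      intro c hc
      rcases lt_or_gt_of_ne hc.ne with hlt | hlt
      · exact Or.inl (.single ⟨hlt, hc⟩)
      · exact Or.inr (.single ⟨hlt, hc.symm⟩)
    | @tail a' a hba haa' ih =>
      intro c hc
      rcases lt_or_gt_of_ne hc.ne with hlt | hlt
      · by_cases hca : c = a'
        · exact Or.inr (hca ▸ hba)
        · exact ih c (h.adj_of_adj_right hlt haa'.1 hca hc haa'.2)
      · exact Or.inr (.tail (.tail hba haa') ⟨hlt, hc.symm⟩)
  obtain ⟨walk⟩ := hab
  induction walk with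
  | nil => exact Or.inl .refl
  | cons hadj _ ih => exact ih.elim (fun ih => h1 ih _ hadj) (fun ih => h2 ih _ hadj)

/-- A monotone path between consecutive integers has no room for an intermediate vertex. -/
theorem IsClosedGraph.adj_succ (h : IsClosedGraph G) (hconn : G.Connected) {i j : Fin n}
    (hij : (i : ℕ) + 1 = j) : G.Adj i j := by
  have hle : ∀ {a b : Fin n}, Relation.ReflTransGen (fun u v => u < v ∧ G.Adj u v) a b → a ≤ b := by
    intro a b hab
    induction hab with
    | refl => exact le_rfl
    | tail _ hbc ih => exact ih.trans hbc.1.le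
  have hlt : i < j := by rw [Fin.lt_def]; omega
  rcases h.reflTransGen_or (hconn.preconnected i j) with hp | hp
  · rcases hp.cases_head with heq | ⟨k, hik, hkj⟩
    · exact absurd heq hlt.ne
    · have h1 := hik.1
      have h2 := hle hkj
      have : k = j := by rw [Fin.lt_def] at h1; rw [Fin.le_def] at h2; ext; omega
      exact this ▸ hik.2
  · exact absurd (hle hp) hlt.not_ge

/-- Raise the lower end of the edge one step at a time, using edges between consecutive vertices;
then `k` and `l` are both joined to `j` from below, unless `l = j`. -/
theorem IsClosedGraph.adj_of_le (h : IsClosedGraph G) (hconn : G.Connected) {i j k l : Fin n}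
    (hij : G.Adj i j) (hik : i ≤ k) (hkl : k < l) (hlj : l ≤ j) : G.Adj k l := by
  have key : ∀ m : ℕ, ∀ k : Fin n, (k : ℕ) = i + m → k < j → G.Adj k j := by
    intro m
    induction m with
    | zero =>
      intro k hk _
      have : k = i := by ext; omega
      exact this ▸ hij
    | succ m ih =>
      intro k hk hkj
      let k' : Fin n := ⟨i + m, by omega⟩
      have hk'k : k' < k := by rw [Fin.lt_def]; simp only [k']; omega
      exact h.adj_of_adj_left hk'k (hk'k.trans hkj) hkj.ne
        (h.adj_succ hconn (by simp only [k']; omega)) (ih k' rfl (hk'k.trans hkj))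
  have key' : ∀ k : Fin n, i ≤ k → k < j → G.Adj k j := fun k hik hkj =>
    key (k - i) k (by rw [Fin.le_def] at hik; omega) hkj
  have hkj := key' k hik (hkl.trans_le hlj)
  rcases hlj.eq_or_lt with rfl | hlt
  · exact hkj
  · exact h.adj_of_adj_right (hkl.trans hlt) hlt hkl.ne hkj (key' l (hik.trans hkl.le) hlt)

end Closed

/-! ### Facets as intervals and the separators between them -/

section Facets

variable {n r : ℕ} {G : SimpleGraph (Fin n)} {F : Fin (r + 1) → Finset (Fin n)}

/-- The interval structure of the facets of a connected closed graph: `[lo i, hi i]` is the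
intersection of the `i`-th and the next facet. Two vertices are adjacent if and only if no such
intersection separates them. -/
structure IsSeparatorSystem (G : SimpleGraph (Fin n)) (lo hi : Fin r → Fin n) : Prop where
  lo_strictMono : StrictMono lo
  hi_strictMono : StrictMono hi
  lo_le_hi : ∀ i, lo i ≤ hi i
  lo_pos : ∀ i, 0 < (lo i : ℕ)
  hi_lt : ∀ i, (hi i : ℕ) + 1 < n
  adj_iff : ∀ p q, p < q → (G.Adj p q ↔ ∀ i, p < lo i → q ≤ hi i)

theorem exists_isSeparatorSystem (hconn : G.Connected) (hclosed : IsClosedGraph G)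
    (hF : IsFacetList G F) : ∃ lo hi : Fin r → Fin n, IsSeparatorSystem G lo hi ∧
      ∀ i, connCutSet F i = Finset.Icc (lo i) (hi i) := by
  classical
  obtain ⟨hmax, hmono⟩ := hF
  have hFmax : ∀ i, Maximal (fun u : Finset (Fin n) => G.IsClique (u : Set (Fin n))) (F i) :=
    fun i => (hmax _).1 ⟨i, rfl⟩
  have hcover : ∀ s : Finset (Fin n), G.IsClique (s : Set (Fin n)) → ∃ i, s ⊆ F i := by
    intro s hs
    obtain ⟨m, hsm, hm⟩ := (Set.toFinite
      {u : Finset (Fin n) | G.IsClique (u : Set (Fin n))}).exists_le_maximal hs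
    obtain ⟨i, rfl⟩ := (hmax m).2 hm
    exact ⟨i, hsm⟩
  have hsub : ∀ i k, F i ⊆ F k → i = k := by
    intro i k hik
    have : F i = F k := (hFmax i).eq_of_le (hFmax k).prop hik
    exact hmono.injective (by simp only [this])
  have hne : ∀ i, (F i).Nonempty := by
    intro i
    rw [Finset.nonempty_iff_ne_empty]
    intro h0
    obtain ⟨v⟩ := hconn.nonempty
    obtain ⟨k, hk⟩ := hcover {v} (by simp)
    have := hsub i k (by simp [h0])
    rw [← this, h0] at hk
    simp at hk
  let a : Fin (r + 1) → Fin n := fun i => (F i).min' (hne i)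
  let b : Fin (r + 1) → Fin n := fun i => (F i).max' (hne i)
  have ha : StrictMono a := by
    intro i k hik
    have := hmono hik
    simp only [← Finset.coe_min' (hne _)] at this
    exact WithTop.coe_lt_coe.1 this
  have hab : ∀ i, a i ≤ b i := fun i => Finset.min'_le_max' _ (hne i)
  have hadj : ∀ i p q, a i ≤ p → p < q → q ≤ b i → G.Adj p q := by
    intro i p q hp hpq hq
    have hlt : a i < b i := hp.trans_lt (hpq.trans_le hq)
    exact hclosed.adj_of_le hconn
      ((hFmax i).prop (Finset.min'_mem _ (hne i)) (Finset.max'_mem _ (hne i)) hlt.ne) hp hpq hq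
  have hIcc : ∀ i, F i = Finset.Icc (a i) (b i) := by
    intro i
    refine (hFmax i).eq_of_le ?_ fun v hv =>
      Finset.mem_Icc.2 ⟨Finset.min'_le (F i) v hv, Finset.le_max' (F i) v hv⟩
    intro p hp q hq hpq
    simp only [Finset.coe_Icc, Set.mem_Icc] at hp hq
    rcases lt_or_gt_of_ne hpq with hlt | hlt
    · exact hadj i p q hp.1 hlt hq.2
    · exact (hadj i q p hq.1 hlt hp.2).symm
  have hb : StrictMono b := by
    intro i k hik
    by_contra! hle
    refine hik.ne' (hsub k i ?_)
    rw [hIcc i, hIcc k]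
    exact Finset.Icc_subset_Icc (ha hik).le hle
  have hadj_iff : ∀ p q, p < q → G.Adj p q → ∃ k, a k ≤ p ∧ q ≤ b k := by
    intro p q hpq h
    obtain ⟨k, hk⟩ := hcover {p, q} (by simp [h])
    rw [hIcc k, Finset.insert_subset_iff, Finset.singleton_subset_iff, Finset.mem_Icc,
      Finset.mem_Icc] at hk
    exact ⟨k, hk.1.1, hk.2.2⟩
  have hmem : ∀ p, ∃ k, a k ≤ p ∧ p ≤ b k := by
    intro p
    obtain ⟨k, hk⟩ := hcover {p} (by simp)
    rw [hIcc k, Finset.singleton_subset_iff, Finset.mem_Icc] at hk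
    exact ⟨k, hk⟩
  -- A facet containing both would have index at most `i` by its left end and greater than `i` by
  -- its right end.
  have hsep : ∀ (i : Fin r) p q, p < a i.succ → b i.castSucc < q →
      ¬ ∃ k, a k ≤ p ∧ q ≤ b k := by
    rintro i p q hp hq ⟨k, hk1, hk2⟩
    have h1 : k < i.succ := ha.lt_iff_lt.1 (hk1.trans_lt hp)
    have h2 : i.castSucc < k := hb.lt_iff_lt.1 (hq.trans_le hk2)
    rw [Fin.lt_def] at h1 h2
    simp at h1 h2
    omega
  refine ⟨fun i => a i.succ, fun i => b i.castSucc, ⟨?_, ?_, ?_, ?_, ?_, ?_⟩, ?_⟩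
  · exact ha.comp Fin.strictMono_succ
  · exact hb.comp Fin.strictMono_castSucc
  · intro i
    by_contra! hlt
    -- If consecutive facets were disjoint, the edge from `b i.castSucc` to its successor would lie
    -- in no facet.
    let q : Fin n := ⟨b i.castSucc + 1, by rw [Fin.lt_def] at hlt; omega⟩
    exact hsep i _ q hlt (by simp [q, Fin.lt_def])
      (hadj_iff _ q (by simp [q, Fin.lt_def]) (hclosed.adj_succ hconn rfl))
  · intro i
    have := ha (Fin.castSucc_lt_succ (i := i))
    rw [Fin.lt_def] at this
    omega
  · intro i
    have := hb (Fin.castSucc_lt_succ (i := i))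
    rw [Fin.lt_def] at this
    omega
  · intro p q hpq
    constructor
    · intro h i hi
      by_contra! hlt
      exact hsep i p q hi hlt (hadj_iff p q hpq h)
    · intro h
      -- Take the last facet starting at or before `p`. If it ended before `q`, the next one would
      -- start after `p`, and the separator between them would contradict `h`.
      obtain ⟨k, hk, hkmax⟩ := (Set.toFinite {k | a k ≤ p}).exists_maximal
        (let ⟨k, hk⟩ := hmem p; ⟨k, hk.1⟩)
      refine hadj k p q hk hpq ?_
      by_contra! hlt
      obtain ⟨k', hk'⟩ := hmem q
      have hkk' : k < k' := hb.lt_iff_lt.1 (hlt.trans_le hk'.2)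
      obtain ⟨i, rfl⟩ : ∃ i : Fin r, k = i.castSucc := by
        refine ⟨⟨k, ?_⟩, rfl⟩
        rw [Fin.lt_def] at hkk'
        omega
      refine hlt.not_ge (h i ?_)
      by_contra! hle
      exact Fin.castSucc_lt_succ.not_ge (hkmax hle Fin.castSucc_lt_succ.le)
  · intro i
    ext v
    have h1 : a i.castSucc ≤ a i.succ := (ha Fin.castSucc_lt_succ).le
    have h2 : b i.castSucc ≤ b i.succ := (hb Fin.castSucc_lt_succ).le
    rw [connCutSet, hIcc, hIcc]
    simp only [Finset.mem_inter, Finset.mem_Icc]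
    exact ⟨fun h => ⟨h.2.1, h.1.2⟩, fun h => ⟨⟨h1.trans h.1, h.2⟩, h.1, h.2.trans h2⟩⟩

end Facets

/-! ### Cut sets as separated unions of separators -/

section Separators

variable {n r : ℕ} {G : SimpleGraph (Fin n)} {lo hi : Fin r → Fin n} {W : Finset (Fin n)}

namespace IsSeparatorSystem

theorem adj_of_le (h : IsSeparatorSystem G lo hi) {p q p' q' : Fin n} (hpq : G.Adj p q)
    (hp : p ≤ p') (hlt : p' < q') (hq : q' ≤ q) : G.Adj p' q' :=
  (h.adj_iff p' q' hlt).2 fun i hi' => hq.trans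
    ((h.adj_iff p q (hp.trans_lt (hlt.trans_le hq))).1 hpq i (hp.trans_lt hi'))

theorem adj_succ (h : IsSeparatorSystem G lo hi) {p q : Fin n} (hpq : (p : ℕ) + 1 = q) :
    G.Adj p q := by
  refine (h.adj_iff p q (by rw [Fin.lt_def]; omega)).2 fun i hi' => ?_
  have := h.lo_le_hi i
  rw [Fin.lt_def] at hi'
  rw [Fin.le_def] at this ⊢
  omega

theorem reachable_of_Icc (h : IsSeparatorSystem G lo hi) {p q : {v : Fin n | v ∉ W}}
    (hpq : (p : Fin n) ≤ q) (hW : ∀ v, (p : Fin n) ≤ v → v ≤ q → v ∉ W) :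
    (deleted G W).Reachable p q := by
  have key : ∀ m : ℕ, ∀ q : {v : Fin n | v ∉ W}, ((q : Fin n) : ℕ) = (p : Fin n) + m →
      (∀ v, (p : Fin n) ≤ v → v ≤ q → v ∉ W) → (deleted G W).Reachable p q := by
    intro m
    induction m with
    | zero =>
      intro q hq _
      have : p = q := by ext; omega
      exact this ▸ .rfl
    | succ m ih =>
      intro q hq hW
      let v : Fin n := ⟨(p : Fin n) + m, by omega⟩
      have hvq : v ≤ q := by rw [Fin.le_def]; simp only [v]; omega
      have hv : v ∉ W := hW v (by rw [Fin.le_def]; simp [v]) hvq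
      refine (ih ⟨v, hv⟩ rfl fun u hu huv => hW u hu (huv.trans hvq)).trans
        (SimpleGraph.Adj.reachable ?_)
      exact h.adj_succ (p := v) (q := q) (by simp only [v]; omega)
  exact key (q - p) q (by rw [Fin.le_def] at hpq; omega) hW

/-- An edge leaving the region below `lo i` ends in `[lo i, hi i]`, which has been deleted. -/
theorem lt_lo_of_reachable (h : IsSeparatorSystem G lo hi) {i : Fin r}
    (hW : Finset.Icc (lo i) (hi i) ⊆ W) {p q : {v : Fin n | v ∉ W}}
    (hpq : (deleted G W).Reachable p q) (hp : (p : Fin n) < lo i) : (q : Fin n) < lo i := by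
  obtain ⟨walk⟩ := hpq
  induction walk with
  | nil => exact hp
  | @cons u v w huv _ ih =>
    refine ih ?_
    by_contra! hle
    have huv' : G.Adj u v := huv
    have := (h.adj_iff u v (hp.trans_le hle)).1 huv' i hp
    exact v.2 (hW (Finset.mem_Icc.2 ⟨hle, this⟩))

/-- A vertex with the cut point property has neighbours on both sides, in distinct components. -/
theorem exists_lt_lt (h : IsSeparatorSystem G lo hi) (hW : HasCutPointProperty G W) {w : Fin n}
    (hw : w ∈ W) : ∃ p q : {v : Fin n | v ∉ W}, (p : Fin n) < w ∧ w < q ∧ G.Adj p w ∧ G.Adj w q ∧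
      ¬ (deleted G W).Reachable p q := by
  obtain ⟨p, q, hp, hq, hpq⟩ := hW w hw
  have hreach : ∀ {p q : {v : Fin n | v ∉ W}}, G.Adj p q → (deleted G W).Reachable p q :=
    fun h => SimpleGraph.Adj.reachable h
  have hne : (p : Fin n) ≠ q := fun heq => hpq (Subtype.ext heq ▸ .rfl)
  rcases lt_or_gt_of_ne hp.ne with hwp | hwp <;> rcases lt_or_gt_of_ne hq.ne with hwq | hwq
  -- Two neighbours of `w` on the same side of it are adjacent, hence in one component.
  · exfalso
    rcases lt_or_gt_of_ne hne with hlt | hlt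
    · exact hpq (hreach (h.adj_of_le hq hwp.le hlt le_rfl))
    · exact hpq (hreach (h.adj_of_le hp hwq.le hlt le_rfl)).symm
  · exact ⟨q, p, hwq, hwp, hq.symm, hp, fun hr => hpq hr.symm⟩
  · exact ⟨p, q, hwp, hwq, hp.symm, hq, hpq⟩
  · exfalso
    rcases lt_or_gt_of_ne hne with hlt | hlt
    · exact hpq (hreach (h.adj_of_le hp.symm le_rfl hlt hwq.le))
    · exact hpq (hreach (h.adj_of_le hq.symm le_rfl hlt hwp.le)).symm

/-- The nearest vertices `p' < w < q'` outside `W` are not adjacent, since otherwise the two sides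
of `w` would be connected. So a separator lies strictly between them, and it fills the whole run of
`W`. -/
theorem exists_separator (h : IsSeparatorSystem G lo hi) (hW : HasCutPointProperty G W) {w : Fin n}
    (hw : w ∈ W) : ∃ i, w ∈ Finset.Icc (lo i) (hi i) ∧ Finset.Icc (lo i) (hi i) ⊆ W ∧
      (∀ p : Fin n, (p : ℕ) + 1 = lo i → p ∉ W) ∧ ∀ q : Fin n, (hi i : ℕ) + 1 = q → q ∉ W := by
  have hreach : ∀ {p q : {v : Fin n | v ∉ W}}, G.Adj p q → (deleted G W).Reachable p q :=
    fun h => SimpleGraph.Adj.reachable h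
  obtain ⟨p, q, hpw, hwq, hap, haq, hpq⟩ := h.exists_lt_lt hW hw
  obtain ⟨p', hpp', ⟨hp'w, hp'W⟩, hp'max⟩ := (Set.toFinite {v : Fin n | v < w ∧ v ∉ W}).exists_le_maximal
    (show (p : Fin n) ∈ {v : Fin n | v < w ∧ v ∉ W} from ⟨hpw, p.2⟩)
  obtain ⟨q', hqq', ⟨hq'w, hq'W⟩, hq'min⟩ := (Set.toFinite {v : Fin n | w < v ∧ v ∉ W}).exists_le_minimal
    (show (q : Fin n) ∈ {v : Fin n | w < v ∧ v ∉ W} from ⟨hwq, q.2⟩)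
  have hpp'r : (deleted G W).Reachable p ⟨p', hp'W⟩ := by
    rcases hpp'.eq_or_lt with heq | hlt
    · have : p = ⟨p', hp'W⟩ := Subtype.ext heq
      exact this ▸ .rfl
    · exact hreach (h.adj_of_le hap le_rfl hlt hp'w.le)
  have hqq'r : (deleted G W).Reachable ⟨q', hq'W⟩ q := by
    rcases hqq'.eq_or_lt with heq | hlt
    · have : ⟨q', hq'W⟩ = q := Subtype.ext heq
      exact this ▸ .rfl
    · exact hreach (h.adj_of_le haq hq'w.le hlt le_rfl)
  have hnadj : ¬ G.Adj p' q' := fun hadj =>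
    hpq (hpp'r.trans ((hreach (p := ⟨p', hp'W⟩) (q := ⟨q', hq'W⟩) hadj).trans hqq'r))
  have hbetween : ∀ v, p' < v → v < q' → v ∈ W := by
    intro v hpv hvq
    by_contra hv
    rcases lt_trichotomy v w with hvw | rfl | hvw
    · exact hpv.not_ge (hp'max ⟨hvw, hv⟩ hpv.le)
    · exact hv hw
    · exact hvq.not_ge (hq'min ⟨hvw, hv⟩ hvq.le)
  rw [h.adj_iff p' q' (hp'w.trans hq'w)] at hnadj
  push Not at hnadj
  obtain ⟨i, hi1, hi2⟩ := hnadj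
  have hlohi := h.lo_le_hi i
  rw [Fin.lt_def] at hp'w hq'w hi1 hi2
  rw [Fin.le_def] at hlohi
  -- The first vertex of the run has a right neighbour outside `W`, so it is adjacent to `q'`; as
  -- `hi i < q'`, it cannot lie below `lo i`. `hhi` is symmetric.
  have hlo : (p' : ℕ) + 1 = lo i := by
    let u : Fin n := ⟨p' + 1, by omega⟩
    have hu : u ∈ W := hbetween u (by simp [u, Fin.lt_def]) (by rw [Fin.lt_def]; simp only [u]; omega)
    obtain ⟨-, Q, -, huQ, -, haQ, -⟩ := h.exists_lt_lt hW hu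
    have hq'Q : q' ≤ Q := by
      by_contra! hlt
      exact Q.2 (hbetween Q (lt_trans (by simp [u, Fin.lt_def]) huQ) hlt)
    have huq' : u < q' := by rw [Fin.lt_def]; simp only [u]; omega
    have := (h.adj_iff u q' huq').1 (h.adj_of_le haQ le_rfl huq' hq'Q) i
    rw [Fin.lt_def, Fin.le_def] at this
    simp only [u] at this
    omega
  have hhi : (hi i : ℕ) + 1 = q' := by
    let u : Fin n := ⟨q' - 1, by omega⟩
    have hpu : p' < u := by rw [Fin.lt_def]; simp only [u]; omega
    have huq : u < q' := by rw [Fin.lt_def]; simp only [u]; omega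
    obtain ⟨P, -, hPu, -, haP, -, -⟩ := h.exists_lt_lt hW (hbetween u hpu huq)
    have hPp' : (P : Fin n) ≤ p' := by
      by_contra! hlt
      exact P.2 (hbetween P hlt (hPu.trans huq))
    have := (h.adj_iff p' u hpu).1 (h.adj_of_le haP hPp' hpu le_rfl) i
    rw [Fin.lt_def, Fin.le_def] at this
    simp only [u] at this
    omega
  refine ⟨i, ?_, fun v hv => ?_, fun p hp => ?_, fun q hq => ?_⟩
  · rw [Finset.mem_Icc, Fin.le_def, Fin.le_def]
    omega
  · rw [Finset.mem_Icc, Fin.le_def, Fin.le_def] at hv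
    exact hbetween v (by rw [Fin.lt_def]; omega) (by rw [Fin.lt_def]; omega)
  · have : p = p' := by ext; omega
    exact this ▸ hp'W
  · have : q = q' := by ext; omega
    exact this ▸ hq'W

end IsSeparatorSystem

/-- `W` is the union of the intervals `[lo (j s), hi (j s)]`, which are pairwise separated. -/
structure IsSeparatedUnion (lo hi : Fin r → Fin n) (W : Finset (Fin n)) {t : ℕ}
    (j : Fin t → Fin r) : Prop where
  strictMono : StrictMono j
  mem_iff : ∀ v, v ∈ W ↔ ∃ s, v ∈ Finset.Icc (lo (j s)) (hi (j s))
  lt : ∀ s s', s < s' → (hi (j s) : ℕ) + 1 < lo (j s')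

theorem isDecomposition_iff (h : IsSeparatorSystem G lo hi) {F : Fin (r + 1) → Finset (Fin n)}
    (hF : ∀ i, connCutSet F i = Finset.Icc (lo i) (hi i)) {t : ℕ} {j : Fin t → Fin r} :
    IsDecomposition F W j ↔ IsSeparatedUnion lo hi W j := by
  simp only [IsDecomposition, hF]
  constructor
  · rintro ⟨hj, rfl, hlt⟩
    refine ⟨hj, by simp, fun s s' hss' => ?_⟩
    rw [Fin.lt_def] at hss'
    let s₁ : Fin t := ⟨s + 1, by omega⟩
    have h1 := hlt s s₁ rfl (hi (j s)) (Finset.right_mem_Icc.2 (h.lo_le_hi _)) (lo (j s₁))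
      (Finset.left_mem_Icc.2 (h.lo_le_hi _))
    have h2 : lo (j s₁) ≤ lo (j s') :=
      h.lo_strictMono.monotone (hj.monotone (by rw [Fin.le_def]; simp only [s₁]; omega))
    rw [Fin.le_def] at h2
    omega
  · intro hU
    refine ⟨hU.strictMono, by ext v; simp [hU.mem_iff], fun s s' hss' u hu v hv => ?_⟩
    have := hU.lt s s' (by rw [Fin.lt_def]; omega)
    rw [Finset.mem_Icc, Fin.le_def, Fin.le_def] at hu hv
    omega

namespace IsSeparatorSystem

theorem exists_isSeparatedUnion (h : IsSeparatorSystem G lo hi) (hne : W.Nonempty)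
    (hW : HasCutPointProperty G W) :
    ∃ t : ℕ, 1 ≤ t ∧ ∃ j : Fin t → Fin r, IsSeparatedUnion lo hi W j := by
  classical
  -- Only separators that are entire runs of `W` are kept; smaller ones inside a run would break the
  -- gap condition.
  let J : Finset (Fin r) := Finset.univ.filter fun i => Finset.Icc (lo i) (hi i) ⊆ W ∧
      (∀ p : Fin n, (p : ℕ) + 1 = lo i → p ∉ W) ∧ ∀ q : Fin n, (hi i : ℕ) + 1 = q → q ∉ W
  have hJ : ∀ s, J.orderEmbOfFin rfl s ∈ J := J.orderEmbOfFin_mem rfl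
  have hmem : ∀ v, v ∈ W ↔ ∃ s, v ∈
      Finset.Icc (lo (J.orderEmbOfFin rfl s)) (hi (J.orderEmbOfFin rfl s)) := by
    intro v
    constructor
    · intro hv
      obtain ⟨i, hvi, hi'⟩ := h.exists_separator hW hv
      have hiJ : i ∈ J := Finset.mem_filter.2 ⟨Finset.mem_univ _, hi'⟩
      have : i ∈ Set.range (J.orderEmbOfFin rfl) := by
        rw [Finset.range_orderEmbOfFin]; exact hiJ
      obtain ⟨s, rfl⟩ := this
      exact ⟨s, hvi⟩
    · rintro ⟨s, hs⟩
      exact (Finset.mem_filter.1 (hJ s)).2.1 hs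
  refine ⟨#J, ?_, J.orderEmbOfFin rfl, (J.orderEmbOfFin rfl).strictMono, hmem, ?_⟩
  · obtain ⟨w, hw⟩ := hne
    obtain ⟨s, -⟩ := (hmem w).1 hw
    exact Nat.one_le_of_lt s.2
  · intro s s' hss'
    have h1 := (Finset.mem_filter.1 (hJ s)).2.1
    have h2 := (Finset.mem_filter.1 (hJ s')).2.2.1
    have hlt := h.lo_strictMono ((J.orderEmbOfFin rfl).strictMono hss')
    rw [Fin.lt_def] at hlt
    by_contra! hle
    -- Without a gap, the vertex just before the later interval would lie in the earlier one, hence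
    -- in `W`.
    refine h2 ⟨lo (J.orderEmbOfFin rfl s') - 1, by omega⟩ (by simp only []; omega)
      (h1 (Finset.mem_Icc.2 ⟨?_, ?_⟩))
    · rw [Fin.le_def]; simp only []; omega
    · rw [Fin.le_def]; simp only []; omega

variable {t : ℕ} {j : Fin t → Fin r}

theorem notMem_of_add_one_eq_lo (h : IsSeparatorSystem G lo hi) (hU : IsSeparatedUnion lo hi W j)
    {s : Fin t} {p : Fin n} (hp : (p : ℕ) + 1 = lo (j s)) : p ∉ W := by
  rw [hU.mem_iff]
  rintro ⟨s', hs'⟩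
  rw [Finset.mem_Icc, Fin.le_def, Fin.le_def] at hs'
  rcases lt_trichotomy s s' with hlt | rfl | hlt
  · have := h.lo_strictMono (hU.strictMono hlt)
    rw [Fin.lt_def] at this
    omega
  · omega
  · have := hU.lt _ _ hlt
    omega

theorem notMem_of_hi_add_one_eq (h : IsSeparatorSystem G lo hi) (hU : IsSeparatedUnion lo hi W j)
    {s : Fin t} {q : Fin n} (hq : (hi (j s) : ℕ) + 1 = q) : q ∉ W := by
  rw [hU.mem_iff]
  rintro ⟨s', hs'⟩
  rw [Finset.mem_Icc, Fin.le_def, Fin.le_def] at hs'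
  rcases lt_trichotomy s s' with hlt | rfl | hlt
  · have := hU.lt _ _ hlt
    omega
  · omega
  · have := h.hi_strictMono (hU.strictMono hlt)
    rw [Fin.lt_def] at this
    omega

theorem Icc_subset (hU : IsSeparatedUnion lo hi W j) (s : Fin t) :
    Finset.Icc (lo (j s)) (hi (j s)) ⊆ W := fun v hv => (hU.mem_iff v).2 ⟨s, hv⟩

/-- The vertices just outside the interval containing `w` serve as witnesses: strict monotonicity of
`lo` and `hi` leaves no separator between either of them and `w`, while the interval itself
disconnects them. -/
theorem hasCutPointProperty (h : IsSeparatorSystem G lo hi) (hU : IsSeparatedUnion lo hi W j) :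
    HasCutPointProperty G W := by
  intro w hw
  obtain ⟨s, hs⟩ := (hU.mem_iff w).1 hw
  rw [Finset.mem_Icc, Fin.le_def, Fin.le_def] at hs
  have hpos := h.lo_pos (j s)
  have hlt := h.hi_lt (j s)
  have hle := h.lo_le_hi (j s)
  rw [Fin.le_def] at hle
  obtain ⟨p, hp⟩ : ∃ p : Fin n, (p : ℕ) + 1 = lo (j s) :=
    ⟨⟨lo (j s) - 1, by omega⟩, by simp only []; omega⟩
  obtain ⟨q, hq⟩ : ∃ q : Fin n, (hi (j s) : ℕ) + 1 = q := ⟨⟨hi (j s) + 1, hlt⟩, rfl⟩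
  have hpw : p < w := by rw [Fin.lt_def]; omega
  have hwq : w < q := by rw [Fin.lt_def]; omega
  refine ⟨⟨p, h.notMem_of_add_one_eq_lo hU hp⟩, ⟨q, h.notMem_of_hi_add_one_eq hU hq⟩,
    ((h.adj_iff p w hpw).2 fun i hi' => ?_).symm, (h.adj_iff w q hwq).2 fun i hi' => ?_,
    fun hr => ?_⟩
  · have : lo (j s) ≤ lo i := by rw [Fin.lt_def] at hi'; rw [Fin.le_def]; omega
    have := h.hi_strictMono.monotone (h.lo_strictMono.le_iff_le.1 this)
    rw [Fin.le_def] at this ⊢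
    omega
  · have : lo (j s) < lo i := by rw [Fin.lt_def] at hi' ⊢; omega
    have := h.hi_strictMono (h.lo_strictMono.lt_iff_lt.1 this)
    rw [Fin.lt_def] at this
    rw [Fin.le_def]
    omega
  · have := h.lt_lo_of_reachable (Icc_subset hU s) hr
      (show p < lo (j s) by rw [Fin.lt_def]; omega)
    rw [Fin.lt_def] at this
    simp only [] at this
    omega

/-- The sets of intervals to the left of two vertices are nested, so equal cardinality means that no
deleted interval lies between them. -/
theorem reachable_iff (h : IsSeparatorSystem G lo hi) (hU : IsSeparatedUnion lo hi W j)
    {p q : {v : Fin n | v ∉ W}} : (deleted G W).Reachable p q ↔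
      #{s | hi (j s) < p} = #{s | hi (j s) < q} := by
  have hiff : ∀ (s : Fin t) (v : {v : Fin n | v ∉ W}), hi (j s) < v ↔ ¬ (v : Fin n) < lo (j s) := by
    intro s v
    constructor
    · exact fun hlt => ((h.lo_le_hi _).trans hlt.le).not_gt
    · intro hle
      by_contra! hlt
      exact v.2 (Icc_subset hU s (Finset.mem_Icc.2 ⟨not_lt.1 hle, hlt⟩))
  have key : ∀ p q : {v : Fin n | v ∉ W}, (p : Fin n) ≤ q →
      #{s | hi (j s) < p} = #{s | hi (j s) < q} → (deleted G W).Reachable p q := by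
    intro p q hpq hcard
    have hsub : ({s | hi (j s) < p} : Finset (Fin t)) ⊆ ({s | hi (j s) < q} : Finset (Fin t)) :=
      fun s hs => by
        simp only [Finset.mem_filter, Finset.mem_univ, true_and] at hs ⊢
        exact hs.trans_le hpq
    have heq := Finset.eq_of_subset_of_card_le hsub hcard.ge
    refine h.reachable_of_Icc hpq fun v hpv hvq hv => ?_
    obtain ⟨s, hs⟩ := (hU.mem_iff v).1 hv
    rw [Finset.mem_Icc] at hs
    have hs' : s ∈ ({s | hi (j s) < q} : Finset (Fin t)) := by
      simpa [hiff] using hs.1.trans hvq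
    rw [← heq, Finset.mem_filter] at hs'
    exact (hs'.2.trans_le (hpv.trans hs.2)).false
  constructor
  · intro hr
    congr 1
    ext s
    simp only [Finset.mem_filter, Finset.mem_univ, true_and, hiff]
    exact not_congr ⟨h.lt_lo_of_reachable (Icc_subset hU s) hr,
      h.lt_lo_of_reachable (Icc_subset hU s) hr.symm⟩
  · intro hcard
    rcases le_total (p : Fin n) q with hpq | hpq
    · exact key p q hpq hcard
    · exact (key q p hpq hcard.symm).symm

theorem card_connectedComponent (h : IsSeparatorSystem G lo hi) (hU : IsSeparatedUnion lo hi W j)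
    (ht : 1 ≤ t) : Nat.card (deleted G W).ConnectedComponent = t + 1 := by
  let f : {v : Fin n | v ∉ W} → Fin (t + 1) := fun v =>
    ⟨#{s | hi (j s) < v}, Nat.lt_succ_of_le ((Finset.card_le_univ _).trans (by simp))⟩
  have hf : ∀ p q, (deleted G W).Reachable p q ↔ f p = f q := fun p q => by
    rw [h.reachable_iff hU, Fin.ext_iff]
  let g : (deleted G W).ConnectedComponent → Fin (t + 1) :=
    Quot.lift f fun p q hpq => (hf p q).1 hpq
  have hg : Function.Bijective g := by
    constructor
    · rintro ⟨p⟩ ⟨q⟩ hpq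
      exact SimpleGraph.ConnectedComponent.sound ((hf p q).2 hpq)
    -- Value 0 is attained just before the first interval, and `k + 1` just after the interval with
    -- index `k`.
    · intro k
      induction k using Fin.cases with
      | zero =>
        let s₀ : Fin t := ⟨0, ht⟩
        have hpos := h.lo_pos (j s₀)
        obtain ⟨p, hp⟩ : ∃ p : Fin n, (p : ℕ) + 1 = lo (j s₀) :=
          ⟨⟨lo (j s₀) - 1, by omega⟩, by simp only []; omega⟩
        refine ⟨(deleted G W).connectedComponentMk ⟨p, h.notMem_of_add_one_eq_lo hU hp⟩, ?_⟩
        change f _ = 0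
        rw [Fin.ext_iff]
        change #{s | hi (j s) < p} = 0
        rw [Finset.card_eq_zero, Finset.filter_eq_empty_iff]
        intro s _
        have h1 := h.lo_le_hi (j s)
        have h2 : lo (j s₀) ≤ lo (j s) :=
          h.lo_strictMono.monotone (hU.strictMono.monotone (Nat.zero_le _))
        rw [Fin.le_def] at h1 h2
        rw [Fin.lt_def]
        omega
      | succ k =>
        obtain ⟨q, hq⟩ : ∃ q : Fin n, (hi (j k) : ℕ) + 1 = q :=
          ⟨⟨hi (j k) + 1, h.hi_lt (j k)⟩, rfl⟩
        refine ⟨(deleted G W).connectedComponentMk ⟨q, h.notMem_of_hi_add_one_eq hU hq⟩, ?_⟩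
        change f _ = k.succ
        rw [Fin.ext_iff]
        change #{s | hi (j s) < q} = k + 1
        have : ({s | hi (j s) < q} : Finset (Fin t)) = Finset.Iic k := by
          ext s
          simp only [Finset.mem_filter, Finset.mem_univ, true_and, Finset.mem_Iic]
          rw [← (h.hi_strictMono.comp hU.strictMono).le_iff_le, Fin.lt_def, Fin.le_def,
            Function.comp_apply, Function.comp_apply]
          omega
        rw [this, Fin.card_Iic]
  rw [Nat.card_eq_of_bijective g hg, Nat.card_eq_fintype_card, Fintype.card_fin]

theorem card_eq_sum (hU : IsSeparatedUnion lo hi W j) :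
    #W = ∑ s, #(Finset.Icc (lo (j s)) (hi (j s))) := by
  have : W = Finset.univ.biUnion fun s => Finset.Icc (lo (j s)) (hi (j s)) := by
    ext v
    simp [hU.mem_iff]
  rw [this, Finset.card_biUnion]
  have key : ∀ s s', s < s' →
      Disjoint (Finset.Icc (lo (j s)) (hi (j s))) (Finset.Icc (lo (j s')) (hi (j s'))) := by
    intro s s' hss'
    have := hU.lt s s' hss'
    rw [Finset.disjoint_left]
    intro v hv hv'
    rw [Finset.mem_Icc, Fin.le_def, Fin.le_def] at hv hv'
    omega
  intro s _ s' _ hne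
  rcases lt_or_gt_of_ne hne with hlt | hlt
  · exact key s s' hlt
  · exact (key s' s hlt).symm

end IsSeparatorSystem

end Separators

end BinomialEdge

theorem proposition1p4 {K : Type*} [Field K] {n r : ℕ} (G : SimpleGraph (Fin n))
    (hconn : G.Connected) (hclosed : BinomialEdge.IsClosedGraph G)
    (F : Fin (r + 1) → Finset (Fin n)) (hF : BinomialEdge.IsFacetList G F)
    (W : Finset (Fin n)) (hW : W.Nonempty) :
    (BinomialEdge.IsCutSet K G W ↔
      ∃ t : ℕ, 1 ≤ t ∧ ∃ j : Fin t → Fin r, BinomialEdge.IsDecomposition F W j) ∧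
    ∀ t : ℕ, 1 ≤ t → ∀ j : Fin t → Fin r, BinomialEdge.IsDecomposition F W j →
      ringKrullDim (BinomialEdge.PolyRing K n ⧸ BinomialEdge.primeP K G W)
          ≤ ((n + 1 : ℕ) : WithBot ℕ∞) ∧
      (ringKrullDim (BinomialEdge.PolyRing K n ⧸ BinomialEdge.primeP K G W)
          = ((n + 1 : ℕ) : WithBot ℕ∞) ↔
        ∀ i : Fin t, #(BinomialEdge.connCutSet F (j i)) = 1) := by
  obtain ⟨lo, hi, h, hIcc⟩ := BinomialEdge.exists_isSeparatorSystem hconn hclosed hF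
  simp only [BinomialEdge.isDecomposition_iff h hIcc, BinomialEdge.isCutSet_iff hW]
  refine ⟨⟨h.exists_isSeparatedUnion hW, fun ⟨t, _, j, hU⟩ => h.hasCutPointProperty hU⟩, ?_⟩
  intro t ht j hU
  rw [BinomialEdge.ringKrullDim_quotient_primeP, h.card_connectedComponent hU ht]
  simp only [hIcc]
  have hcard := BinomialEdge.IsSeparatorSystem.card_eq_sum hU
  -- This keeps the natural subtraction `n - #W` from truncating; the rest compares `#W`, a sum of
  -- `t` positive terms, with `t`.
  have hle : #W ≤ n := by simpa using Finset.card_le_univ W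
  have hpos : ∀ s ∈ (Finset.univ : Finset (Fin t)), 1 ≤ #(Finset.Icc (lo (j s)) (hi (j s))) :=
    fun s _ => Finset.card_pos.2 (Finset.nonempty_Icc.2 (h.lo_le_hi _))
  have hsum := Finset.sum_le_sum hpos
  have hsum_iff := Finset.sum_eq_sum_iff_of_le hpos
  rw [← hcard] at hsum hsum_iff
  simp only [Finset.sum_const, Finset.card_univ, Fintype.card_fin, smul_eq_mul, mul_one,
    Finset.mem_univ, true_implies] at hsum hsum_iff
  refine ⟨by exact_mod_cast (show n - #W + (t + 1) ≤ n + 1 by omega), ?_⟩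
  have hiff : n - #W + (t + 1) = n + 1 ↔ t = #W := by omega
  rw [show (((n - #W + (t + 1) : ℕ) : WithBot ℕ∞) = ((n + 1 : ℕ) : WithBot ℕ∞)) ↔
    n - #W + (t + 1) = n + 1 by exact_mod_cast Iff.rfl, hiff, hsum_iff]
  exact forall_congr' fun _ => eq_comm
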